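/- Let $\varphi(x,y)=(a+by-x^2,\,x)$ be the Hénon map on the Euclidean plane $\mathbb R^2$. (i) Let $a\in\mathbb R$, $b\neq 0$, $|b|<1$. At every point $(x,y)$ the Jacobian $D\varphi(x,y)$ has the singular values $$\sigma_1(x)=\tfrac12\Big(\sqrt{4x^2+(1+|b|)^2}+\sqrt{4x^2+(1-|b|)^2}\Big)\ge 1,\qquad \sigma_2(x)=\frac{|b|}{\sigma_1(x)}\le |b|.$$ For a nonempty closed bounded set $K\subset\mathbb R^2$ that is invariant ($\varphi^t(K)=K$ for all integers $t\ge 0$), put $\Phi(t,u)=D\varphi(\varphi^{t-1}(u))\cdots D\varphi(u)$, let $\sigma_1(t,u)\ge\sigma_2(t,u)>0$ be the singular values of $\Phi(t,u)$, and $\lambda_i(t,u)=\frac1t\ln\sigma_i(t,u)$ for $t\ge 1$. Let $\dim_{\rm L}(t,u)$ be $0$ if $\lambda_1<0$ (and hence $\lambda_1+\lambda_2<0$), $1+\lambda_1/|\lambda_2|$ if $\lambda_1\ge0>\lambda_1+\lambda_2$, and $2$ if $\lambda_1+\lambda_2\ge 0$ (the Kaplan–Yorke formula), and let the Lyapunov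 dimension of $K$ be $\dim_{\rm L}K=\liminf_{t\to\infty}\sup_{u\in K}\dim_{\rm L}(t,u)$. Let $\dim_{\rm H}$ be the Hausdorff dimension. (ii) Let $a>0$, $0<b<1$, $m=\frac{a(1+2b)}{1-b}$, $r=-\frac{1+\sqrt{1+4a}}2$, and let $\mathcal B=\overline M\setminus(Q\cup R_1\cup R_2)$ be Feit's region, where $$M=\{x<m,\ y<m+a\},\quad Q=\{x<r,\ y<0\},$$ $$R_1=\{x<-\sqrt{b(m+a)+a-r},\ y\le m+a\},\quad R_2=\{x\le m,\ y<-\tfrac1b(a+\sqrt{a+bm-r})\}.$$ Then every nonempty closed bounded invariant set $K\subseteq\mathcal B$ satisfies $$\dim_{\rm H}K\le\dim_{\rm L}K\le 1+\left(1-\frac{\ln b}{\ln\sigma_1\big(\max\{-r,\ m,\ \sqrt{b(m+a)+a-r}\}\big)}\right)^{-1}.$$ (iii) For $a=1.4$, $b=0.3$, every nonempty closed bounded invariant set $K\subseteq\mathcal B$ satisfies $\dim_{\rm H}K\le\dim_{\rm L}K\le 1.5319$. -/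

import Mathlib

open Filter

noncomputable section

namespace Henon

/-- The Euclidean plane. -/
abbrev Plane : Type := EuclideanSpace ℝ (Fin 2)

/-- The Hénon map `(x, y) ↦ (a + b y - x², x)`. -/
def henonMap (a b : ℝ) (u : Plane) : Plane :=
  !₂[a + b * u 1 - u 0 ^ 2, u 0]

/-- The `i`-th singular value of a linear map of the plane, in decreasing order and counted from
`i = 0`: the square roots of the eigenvalues of `A* A`, with multiplicity. -/
def sing (A : Plane →L[ℝ] Plane) (i : ℕ) : ℝ :=
  (A : Plane →ₗ[ℝ] Plane).singularValues i

/-- The fundamental matrix of the linearization along the orbit of `u`: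
`Φ(0, u) = I`, `Φ(t + 1, u) = Dφ(φ^t(u)) Φ(t, u)`. -/
def fundamental (φ : Plane → Plane) : ℕ → Plane → (Plane →L[ℝ] Plane)
  | 0, _ => ContinuousLinearMap.id ℝ Plane
  | t + 1, u => (fderiv ℝ φ (φ^[t] u)).comp (fundamental φ t u)

/-- The finite-time Lyapunov exponents `(1/t) ln σ_i(t, u)`, meant for `t > 0`. -/
def lyapunovExponent (φ : Plane → Plane) (t : ℕ) (u : Plane) (i : ℕ) : ℝ :=
  (1 / (t : ℝ)) * Real.log (sing (fundamental φ t u) i)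

/-- `max {m ≤ n : l 0 + ⋯ + l (m - 1) ≥ 0}`; the empty sum `m = 0` always qualifies. -/
def kaplanYorkeIndex (n : ℕ) (l : ℕ → ℝ) : ℕ :=
  Nat.findGreatest (fun m => 0 ≤ ∑ i ∈ Finset.range m, l i) n

/-- The Kaplan–Yorke dimension of `l 0 ≥ ⋯ ≥ l (n - 1)`. -/
def kaplanYorke (n : ℕ) (l : ℕ → ℝ) : ℝ :=
  if kaplanYorkeIndex n l = n then (n : ℝ)
  else (kaplanYorkeIndex n l : ℝ) +
    (∑ i ∈ Finset.range (kaplanYorkeIndex n l), l i) / |l (kaplanYorkeIndex n l)|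

/-- The finite-time local Lyapunov dimension `dim_L(t, u)`. -/
def localLyapunovDim (φ : Plane → Plane) (t : ℕ) (u : Plane) : ℝ :=
  kaplanYorke 2 (lyapunovExponent φ t u)

/-- The finite-time Lyapunov dimension `dim_L(t, K) = sup_{u ∈ K} dim_L(t, u)`. The local
dimensions are nonnegative, so passing to `[0, ∞]` loses nothing. -/
def finiteTimeLyapunovDim (φ : Plane → Plane) (t : ℕ) (K : Set Plane) : ENNReal :=
  ⨆ u ∈ K, ENNReal.ofReal (localLyapunovDim φ t u)

/-- The Lyapunov dimension `dim_L K = liminf_{t → ∞} sup_{u ∈ K} dim_L(t, u)`. -/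
def lyapunovDim (φ : Plane → Plane) (K : Set Plane) : ENNReal :=
  liminf (fun t : ℕ => finiteTimeLyapunovDim φ t K) atTop

/-- `K` is a nonempty closed bounded set with `φ^t(K) = K` for all `t ≥ 0`. -/
structure IsBoundedInvariant (φ : Plane → Plane) (K : Set Plane) : Prop where
  nonempty : K.Nonempty
  isClosed : IsClosed K
  isBounded : Bornology.IsBounded K
  image_iterate : ∀ t : ℕ, φ^[t] '' K = K

/-- `m = a (1 + 2b) / (1 - b)`. -/
def feitM (a b : ℝ) : ℝ := a * (1 + 2 * b) / (1 - b)

/-- `r = -(1 + √(1 + 4a)) / 2`. -/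
def feitR (a : ℝ) : ℝ := -((1 + √(1 + 4 * a)) / 2)

/-- Feit's localization region `closure M \ (Q ∪ R₁ ∪ R₂)`. -/
def feitRegion (a b : ℝ) : Set Plane :=
  closure {u : Plane | u 0 < feitM a b ∧ u 1 < feitM a b + a} \
    ({u : Plane | u 0 < feitR a ∧ u 1 < 0} ∪
      {u : Plane | u 0 < -√(b * (feitM a b + a) + a - feitR a) ∧ u 1 ≤ feitM a b + a} ∪
      {u : Plane | u 0 ≤ feitM a b ∧
        u 1 < -((1 / b) * (a + √(a + b * feitM a b - feitR a)))})

/-- `σ₁(x) = ½ (√(4x² + (1 + |b|)²) + √(4x² + (1 - |b|)²))`. -/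
def sigmaOne (b x : ℝ) : ℝ :=
  (1 / 2) * (√(4 * x ^ 2 + (1 + |b|) ^ 2) + √(4 * x ^ 2 + (1 - |b|) ^ 2))

/-- `max {-r, m, √(b (m + a) + a - r)}`. -/
def feitRadius (a b : ℝ) : ℝ :=
  max (-feitR a) (max (feitM a b) (√(b * (feitM a b + a) + a - feitR a)))

end Henon

end

/-!
Finite-time exponents bound the Hausdorff dimension by the Douady–Oesterlé argument. If
`ω_d(A) = σ₁(A) σ₂(A)^(d-1)` is less than one for the derivative at every point of `K`, then, `ω_d`
being submultiplicative, it is as small as desired for the derivative of a high iterate. Such an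
iterate maps a small piece of `K` into a thin neighbourhood of an ellipse, which is cut across its
long axis into pieces of size comparable to `σ₂`: this does not increase the `d`-dimensional sum of
a cover of `K` but halves its mesh. If the Kaplan–Yorke dimension of the exponents at time `t` is
less than `d`, where `1 < d ≤ 2`, then `ω_d` of the derivative of the `t`-th iterate is less than
one.

For the upper bound, `|det Dφ| = |b|` is constant and `σ₁(x)` increases with `|x|`, so it is enough
to bound the first coordinate on `K`. At its maximum, `x ≤ a + b x` by invariance. A point with
`x < r` and `y ≤ 0` escapes: its images stay in that quadrant and move left. A point too far left
enters this quadrant after two steps.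
-/

namespace Henon

open Module InnerProductSpace MeasureTheory Metric Set
open scoped RealInnerProductSpace Topology ENNReal NNReal

section SingularValues

theorem sing_nonneg (A : Plane →L[ℝ] Plane) (i : ℕ) : 0 ≤ sing A i :=
  LinearMap.singularValues_nonneg _ i

theorem sing_one_le_sing_zero (A : Plane →L[ℝ] Plane) : sing A 1 ≤ sing A 0 :=
  LinearMap.singularValues_antitone _ zero_le_one

theorem finrank_plane : finrank ℝ Plane = 2 := finrank_euclideanSpace_fin

theorem sing_zero_mul_sing_one (A : Plane →L[ℝ] Plane) : sing A 0 * sing A 1 = |A.det| := by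
  have h := (A : Plane →ₗ[ℝ] Plane).normDet_eq_prod_singularValues
  rw [finrank_plane, Finset.prod_range_succ, Finset.prod_range_one,
    LinearMap.normDet_eq_norm_det] at h
  exact h.symm

theorem exists_orthonormalBasis_norm_apply_eq_sing (A : Plane →L[ℝ] Plane) :
    ∃ e : OrthonormalBasis (Fin 2) ℝ Plane,
      (∀ i, ‖A (e i)‖ = sing A i) ∧ ⟪A (e 0), A (e 1)⟫ = 0 := by
  set T : Plane →ₗ[ℝ] Plane := A.toLinearMap
  have hT := T.isSymmetric_adjoint_comp_self
  set e := hT.eigenvectorBasis finrank_plane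
  have inner_apply : ∀ i j, ⟪A (e i), A (e j)⟫ = sing A j ^ 2 * ⟪e i, e j⟫ := by
    intro i j
    have h := hT.apply_eigenvectorBasis finrank_plane j
    rw [← T.sq_singularValues_fin finrank_plane] at h
    change ⟪T _, T _⟫ = T.singularValues j ^ 2 * _
    rw [← LinearMap.adjoint_inner_right, ← LinearMap.comp_apply, h, inner_smul_right]
    rfl
  refine ⟨e, fun i => ?_, ?_⟩
  · have h := inner_apply i i
    rw [real_inner_self_eq_norm_sq, real_inner_self_eq_norm_sq, e.norm_eq_one, one_pow,
      mul_one] at h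
    exact (sq_eq_sq₀ (norm_nonneg _) (sing_nonneg A i)).1 h
  · rw [inner_apply, e.inner_eq_zero (by decide), mul_zero]

theorem norm_sq_eq_inner_sq_add_inner_sq (e : OrthonormalBasis (Fin 2) ℝ Plane) (v : Plane) :
    ‖v‖ ^ 2 = ⟪e 0, v⟫ ^ 2 + ⟪e 1, v⟫ ^ 2 := by
  simpa [Fin.sum_univ_two] using (e.sum_sq_norm_inner_right v).symm

theorem norm_apply_sq_of_inner_eq_zero {A : Plane →L[ℝ] Plane}
    {e : OrthonormalBasis (Fin 2) ℝ Plane} (he : ⟪A (e 0), A (e 1)⟫ = 0) (v : Plane) :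
    ‖A v‖ ^ 2 = (‖A (e 0)‖ * ⟪e 0, v⟫) ^ 2 + (‖A (e 1)‖ * ⟪e 1, v⟫) ^ 2 := by
  have hv : v = ⟪e 0, v⟫ • e 0 + ⟪e 1, v⟫ • e 1 := by
    rw [← Fin.sum_univ_two (fun i => ⟪e i, v⟫ • e i), e.sum_repr']
  conv_lhs => rw [hv, map_add, map_smul, map_smul]
  rw [norm_add_sq_real, inner_smul_left, inner_smul_right, he, norm_smul, norm_smul]
  simp only [Real.norm_eq_abs, mul_pow, sq_abs]
  ring

theorem sing_zero_sq_add_sing_one_sq (A : Plane →L[ℝ] Plane)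
    (b : OrthonormalBasis (Fin 2) ℝ Plane) :
    sing A 0 ^ 2 + sing A 1 ^ 2 = ‖A (b 0)‖ ^ 2 + ‖A (b 1)‖ ^ 2 := by
  obtain ⟨e, he, -⟩ := exists_orthonormalBasis_norm_apply_eq_sing A
  set T : Plane →ₗ[ℝ] Plane := A.toLinearMap
  have trace_eq : ∀ c : OrthonormalBasis (Fin 2) ℝ Plane,
      LinearMap.trace ℝ Plane (LinearMap.adjoint T ∘ₗ T) = ‖A (c 0)‖ ^ 2 + ‖A (c 1)‖ ^ 2 := by
    intro c
    rw [LinearMap.trace_eq_sum_inner _ c, Fin.sum_univ_two]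
    simp only [LinearMap.comp_apply, LinearMap.adjoint_inner_right, real_inner_self_eq_norm_sq]
    rfl
  rw [← trace_eq b, trace_eq e, he, he]
  rfl

theorem sing_zero_eq_half_sqrt_add_sqrt (A : Plane →L[ℝ] Plane)
    (b : OrthonormalBasis (Fin 2) ℝ Plane) :
    sing A 0 = 1 / 2 * (√(‖A (b 0)‖ ^ 2 + ‖A (b 1)‖ ^ 2 + 2 * |A.det|) +
      √(‖A (b 0)‖ ^ 2 + ‖A (b 1)‖ ^ 2 - 2 * |A.det|)) := by
  rw [← sing_zero_sq_add_sing_one_sq A b, ← sing_zero_mul_sing_one]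
  have hadd : sing A 0 ^ 2 + sing A 1 ^ 2 + 2 * (sing A 0 * sing A 1) =
      (sing A 0 + sing A 1) ^ 2 := by ring
  have hsub : sing A 0 ^ 2 + sing A 1 ^ 2 - 2 * (sing A 0 * sing A 1) =
      (sing A 0 - sing A 1) ^ 2 := by ring
  rw [hadd, hsub, Real.sqrt_sq (add_nonneg (sing_nonneg A 0) (sing_nonneg A 1)),
    Real.sqrt_sq (sub_nonneg.2 (sing_one_le_sing_zero A))]
  ring

theorem sing_zero_eq_norm (A : Plane →L[ℝ] Plane) : sing A 0 = ‖A‖ := by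
  obtain ⟨e, he, horth⟩ := exists_orthonormalBasis_norm_apply_eq_sing A
  refine le_antisymm ?_ (A.opNorm_le_bound (sing_nonneg A 0) fun v => ?_)
  · simpa [he, e.norm_eq_one] using A.le_opNorm (e 0)
  · refine (sq_le_sq₀ (norm_nonneg _) (mul_nonneg (sing_nonneg A 0) (norm_nonneg v))).1 ?_
    rw [norm_apply_sq_of_inner_eq_zero horth, he, he, Fin.val_zero, Fin.val_one,
      mul_pow (sing A 0) ‖v‖, norm_sq_eq_inner_sq_add_inner_sq e v, mul_add, mul_pow, mul_pow]
    gcongr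
    exacts [sing_nonneg A 1, sing_one_le_sing_zero A]

end SingularValues

section SingularValueFunction

/-- The singular value function `σ₁ σ₂ ^ (d - 1)` of order `d ∈ [1, 2]`, which interpolates between
the operator norm and the modulus of the determinant. -/
noncomputable def singularValueFunction (d : ℝ) (A : Plane →L[ℝ] Plane) : ℝ :=
  sing A 0 * sing A 1 ^ (d - 1)

variable {d : ℝ}

theorem singularValueFunction_nonneg (d : ℝ) (A : Plane →L[ℝ] Plane) :
    0 ≤ singularValueFunction d A :=
  mul_nonneg (sing_nonneg A 0) (Real.rpow_nonneg (sing_nonneg A 1) _)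

theorem singularValueFunction_eq_norm_rpow_mul_abs_det_rpow (hd1 : 1 ≤ d) (hd2 : d ≤ 2)
    (A : Plane →L[ℝ] Plane) :
    singularValueFunction d A = ‖A‖ ^ (2 - d) * |A.det| ^ (d - 1) := by
  rw [← sing_zero_mul_sing_one, ← sing_zero_eq_norm,
    Real.mul_rpow (sing_nonneg A 0) (sing_nonneg A 1), ← mul_assoc,
    ← Real.rpow_add_of_nonneg (sing_nonneg A 0) (by linarith) (by linarith),
    show 2 - d + (d - 1) = 1 by ring, Real.rpow_one, singularValueFunction]

theorem singularValueFunction_comp_le (hd1 : 1 ≤ d) (hd2 : d ≤ 2) (A B : Plane →L[ℝ] Plane) :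
    singularValueFunction d (A.comp B) ≤ singularValueFunction d A * singularValueFunction d B := by
  simp only [singularValueFunction_eq_norm_rpow_mul_abs_det_rpow hd1 hd2]
  have hdet : (A.comp B).det = A.det * B.det := LinearMap.det_comp _ _
  calc ‖A.comp B‖ ^ (2 - d) * |(A.comp B).det| ^ (d - 1)
      ≤ (‖A‖ * ‖B‖) ^ (2 - d) * (|A.det| * |B.det|) ^ (d - 1) := by
        rw [hdet, abs_mul]
        gcongr
        exact A.opNorm_comp_le B
    _ = _ := by
        rw [Real.mul_rpow (norm_nonneg A) (norm_nonneg B),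
          Real.mul_rpow (abs_nonneg A.det) (abs_nonneg B.det)]
        ring

theorem singularValueFunction_id (hd1 : 1 ≤ d) (hd2 : d ≤ 2) :
    singularValueFunction d (ContinuousLinearMap.id ℝ Plane) = 1 := by
  have hdet : (ContinuousLinearMap.id ℝ Plane).det = 1 := LinearMap.det_id
  rw [singularValueFunction_eq_norm_rpow_mul_abs_det_rpow hd1 hd2, hdet,
    ContinuousLinearMap.norm_id, abs_one, Real.one_rpow, Real.one_rpow, one_mul]

theorem continuous_singularValueFunction (hd1 : 1 ≤ d) (hd2 : d ≤ 2) :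
    Continuous (singularValueFunction d) := by
  rw [funext (singularValueFunction_eq_norm_rpow_mul_abs_det_rpow hd1 hd2)]
  exact (continuous_norm.rpow_const fun _ => .inr (by linarith)).mul
    (ContinuousLinearMap.continuous_det.abs.rpow_const fun _ => .inr (by linarith))

end SingularValueFunction

section HausdorffPremeasure

variable {X : Type*} [EMetricSpace X] {d : ℝ} {K : Set X} {F : X → X} {ρ δ : ℝ≥0∞}

/-- The `d`-dimensional Hausdorff premeasure at scale `r`: the largest outer measure which assigns
to each set of diameter at most `r` at most the `d`-th power of its diameter. -/
noncomputable def hausdorffPremeasure (d : ℝ) (r : ℝ≥0∞) : OuterMeasure X :=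
  OuterMeasure.mkMetric'.pre (fun s => ediam s ^ d) r

theorem hausdorffPremeasure_le_of_ediam_le (hd : 0 ≤ d) {s : Set X} {r r' : ℝ≥0∞}
    (hs : ediam s ≤ r') (hr : r' ≤ r) : hausdorffPremeasure d r s ≤ r' ^ d :=
  (OuterMeasure.mkMetric'.pre_le (hs.trans hr)).trans (ENNReal.rpow_le_rpow hs hd)

theorem hausdorffPremeasure_le_card_mul {ι : Type*} (hd : 0 ≤ d) {s : Set X} {r : ℝ≥0∞}
    (t : Finset ι) {S : ι → Set X} (hs : s ⊆ ⋃ i ∈ t, S i) (hS : ∀ i ∈ t, ediam (S i) ≤ r) :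
    hausdorffPremeasure d r s ≤ t.card * r ^ d :=
  calc hausdorffPremeasure d r s ≤ ∑ i ∈ t, hausdorffPremeasure d r (S i) :=
        (measure_mono hs).trans (measure_biUnion_finset_le t S)
    _ ≤ t.card * r ^ d := by
        rw [← nsmul_eq_mul]
        exact Finset.sum_le_card_nsmul _ _ _ fun i hi =>
          hausdorffPremeasure_le_of_ediam_le hd (hS i hi) le_rfl

theorem hausdorffPremeasure_lt_top_of_isCompact (hd : 0 ≤ d) (hK : IsCompact K) {r : ℝ≥0∞}
    (hr : 0 < r) : hausdorffPremeasure d r K < ∞ := by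
  refine hK.induction_on (p := fun s => hausdorffPremeasure d r s < ∞) (by simp)
    (fun s t hst ht => (measure_mono hst).trans_lt ht)
    (fun s t hs ht => (measure_union_le s t).trans_lt (ENNReal.add_lt_top.2 ⟨hs, ht⟩))
    fun x _ => ?_
  obtain ⟨q, hq0, hqr⟩ := exists_between hr
  have hq : 2 * (q / 2) = q := ENNReal.mul_div_cancel two_ne_zero ENNReal.ofNat_ne_top
  refine ⟨eball x (q / 2), mem_nhdsWithin_of_mem_nhds
    (eball_mem_nhds x (ENNReal.half_pos hq0.ne')), ?_⟩
  refine (hausdorffPremeasure_le_of_ediam_le hd (ediam_eball_le.trans_eq hq)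
    hqr.le).trans_lt (ENNReal.rpow_lt_top_of_nonneg hd hqr.ne_top)

theorem hausdorffPremeasure_le_rpow_mul (hd : 0 ≤ d) (hKF : K ⊆ F '' K) (hρ0 : ρ ≠ 0)
    (hρ : ρ ≠ ∞)
    (h : ∀ E ⊆ K, ediam E ≤ δ →
      hausdorffPremeasure d (ρ * ediam E) (F '' E) ≤ (ρ * ediam E) ^ d) :
    hausdorffPremeasure d (ρ * δ) K ≤ ρ ^ d * hausdorffPremeasure d δ K := by
  have hρd0 : ρ ^ d ≠ 0 := (ENNReal.rpow_pos (pos_iff_ne_zero.2 hρ0) hρ).ne'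
  have hρd : ρ ^ d ≠ ∞ := ENNReal.rpow_ne_top_of_nonneg hd hρ
  set μ : OuterMeasure X := (ρ ^ d)⁻¹ • OuterMeasure.restrict K
    (OuterMeasure.comap F (hausdorffPremeasure d (ρ * δ)))
  have hμ : μ ≤ hausdorffPremeasure d δ := by
    refine OuterMeasure.mkMetric'.le_pre.2 fun s hs => ?_
    have hsK : ediam (s ∩ K) ≤ ediam s := ediam_mono inter_subset_left
    rw [smul_apply, smul_eq_mul, OuterMeasure.restrict_apply,
      OuterMeasure.comap_apply, ENNReal.inv_mul_le_iff hρd0 hρd]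
    calc hausdorffPremeasure d (ρ * δ) (F '' (s ∩ K))
        ≤ hausdorffPremeasure d (ρ * ediam (s ∩ K)) (F '' (s ∩ K)) :=
          OuterMeasure.mkMetric'.mono_pre _ (by gcongr; exact hsK.trans hs) _
      _ ≤ (ρ * ediam (s ∩ K)) ^ d := h _ inter_subset_right (hsK.trans hs)
      _ ≤ ρ ^ d * ediam s ^ d := by
          rw [← ENNReal.mul_rpow_of_nonneg _ _ hd]
          gcongr
  have hμK := hμ K
  rw [smul_apply, smul_eq_mul, OuterMeasure.restrict_apply, OuterMeasure.comap_apply,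
    inter_self, ENNReal.inv_mul_le_iff hρd0 hρd] at hμK
  exact (measure_mono hKF).trans hμK

theorem dimH_le_of_hausdorffPremeasure_image_le {d : ℝ≥0} (hd : 0 < d) (hK : IsCompact K)
    (hKF : K ⊆ F '' K) (hρ0 : ρ ≠ 0) (hρ : ρ < 1) (hδ : 0 < δ)
    (h : ∀ E ⊆ K, ediam E ≤ δ →
      hausdorffPremeasure d (ρ * ediam E) (F '' E) ≤ (ρ * ediam E) ^ (d : ℝ)) :
    dimH K ≤ d := by
  borelize X
  set ε := min δ 1
  have hε : 0 < ε := lt_min hδ one_pos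
  have hscale : ∀ n : ℕ, ρ ^ n * ε ≤ δ := fun n =>
    (mul_le_of_le_one_left' (pow_le_one₀ zero_le hρ.le)).trans (min_le_left δ 1)
  have hiter : ∀ n : ℕ, hausdorffPremeasure d (ρ ^ n * ε) K ≤
      (ρ ^ (d : ℝ)) ^ n * hausdorffPremeasure d ε K := by
    intro n
    induction n with
    | zero => simp
    | succ n ih =>
      rw [pow_succ', mul_assoc, pow_succ', mul_assoc]
      refine (hausdorffPremeasure_le_rpow_mul d.coe_nonneg hKF hρ0 hρ.ne_top fun E hE hEn =>
        h E hE (hEn.trans (hscale n))).trans ?_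
      gcongr
  have hlim : Tendsto (fun n : ℕ => (ρ ^ (d : ℝ)) ^ n * hausdorffPremeasure d ε K) atTop (𝓝 0) := by
    have hfin := hausdorffPremeasure_lt_top_of_isCompact d.coe_nonneg hK hε
    simpa using ENNReal.Tendsto.mul_const (ENNReal.tendsto_pow_atTop_nhds_zero_of_lt_one
      (ENNReal.rpow_lt_one hρ hd)) (.inr hfin.ne)
  have hzero : Tendsto (fun n : ℕ => ρ ^ n * ε) atTop (𝓝[>] 0) := by
    refine tendsto_nhdsWithin_iff.2 ⟨?_, .of_forall fun n =>
      ENNReal.mul_pos (pow_ne_zero n hρ0) hε.ne'⟩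
    have hε1 : ε ≠ ∞ := ((min_le_right δ 1).trans_lt ENNReal.one_lt_top).ne
    simpa using ENNReal.Tendsto.mul_const
      (ENNReal.tendsto_pow_atTop_nhds_zero_of_lt_one hρ) (.inr hε1)
  have hμ : μH[d] K ≤ 0 := by
    rw [Measure.hausdorffMeasure, ← OuterMeasure.coe_mkMetric]
    exact le_of_tendsto_of_tendsto' ((OuterMeasure.mkMetric'.tendsto_pre _ K).comp hzero) hlim hiter
  exact dimH_le_of_hausdorffMeasure_ne_top (hμ.trans_lt ENNReal.zero_lt_top).ne

end HausdorffPremeasure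

section NearlyLinearMaps

theorem exists_approximatesLinearOn_of_isCompact {𝕜 V W : Type*} [NontriviallyNormedField 𝕜]
    [NormedAddCommGroup V] [NormedSpace 𝕜 V] [NormedAddCommGroup W] [NormedSpace 𝕜 W]
    {K : Set V} (hK : IsCompact K) {F : V → W} {F' : V → V →L[𝕜] W}
    (hF : ∀ u ∈ K, HasStrictFDerivAt F (F' u) u) {c : ℝ≥0} (hc : 0 < c) :
    ∃ δ > 0, ∀ E ⊆ K, E.Nonempty → ediam E ≤ δ →
      ∃ u ∈ K, ApproximatesLinearOn F (F' u) E c := by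
  choose s hs happ using fun u hu => (hF u hu).approximates_deriv_on_nhds (.inr hc)
  obtain ⟨δ, hδ, hsub⟩ := lebesgue_number_lemma_of_emetric_nhds' hK hs
  obtain ⟨ε, hε, hεδ⟩ := exists_between hδ
  refine ⟨ε, hε, fun E hE ⟨v, hv⟩ hEε => ?_⟩
  obtain ⟨u, hu⟩ := hsub v (hE hv)
  refine ⟨u, u.2, (happ u u.2).mono_set fun w hw => hu ?_⟩
  exact ((edist_le_of_ediam_le hw hv hEε).trans_lt hεδ)

theorem dimH_eq_zero_of_norm_fderiv_lt_one {V : Type*} [NormedAddCommGroup V] [NormedSpace ℝ V]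
    {K : Set V} (hK : IsCompact K) {F : V → V} (hF : ContDiff ℝ 1 F) (hKF : K ⊆ F '' K)
    (hlt : ∀ u ∈ K, ‖fderiv ℝ F u‖ < 1) : dimH K = 0 := by
  rcases K.eq_empty_or_nonempty with rfl | hne
  · exact dimH_empty
  obtain ⟨u₀, hu₀, hmax⟩ := hK.exists_isMaxOn hne
    (hF.continuous_fderiv one_ne_zero).nnnorm.continuousOn
  obtain ⟨ρ, hρ, hρ1⟩ := exists_between (show ‖fderiv ℝ F u₀‖₊ < 1 from hlt u₀ hu₀)
  obtain ⟨δ, hδ, happ⟩ := exists_approximatesLinearOn_of_isCompact hK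
    (fun u _ => hF.contDiffAt.hasStrictFDerivAt one_ne_zero) (tsub_pos_of_lt hρ)
  have hlip : ∀ E ⊆ K, ediam E ≤ δ → ediam (F '' E) ≤ ρ * ediam E := by
    intro E hE hEδ
    rcases E.eq_empty_or_nonempty with rfl | hEne
    · simp
    obtain ⟨u, hu, hEu⟩ := happ E hE hEne hEδ
    have hLip : LipschitzOnWith ρ F E :=
      (lipschitzOnWith_iff_restrict.2 hEu.lipschitz).weaken <|
        (add_le_add_left (hmax hu) _).trans_eq (add_tsub_cancel_of_le hρ.le)
    exact ediam_image_le_iff.2 fun v hv w hw =>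
      hLip.edist_le_mul_of_le hv hw (edist_le_ediam_of_mem hv hw)
  refine le_antisymm (ENNReal.le_of_forall_pos_le_add fun d hd _ => ?_) zero_le
  rw [zero_add]
  exact dimH_le_of_hausdorffPremeasure_image_le hd hK hKF
    (ENNReal.coe_ne_zero.2 (bot_le.trans_lt hρ).ne') (ENNReal.coe_lt_one_iff.2 hρ1) hδ
    fun E hE hEδ => hausdorffPremeasure_le_of_ediam_le d.coe_nonneg (hlip E hE hEδ) le_rfl

theorem exists_int_partition_of_abs_sub_le {X : Type*} {E : Set X} {f : X → ℝ} {a ℓ h : ℝ}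
    (hℓ : 0 ≤ ℓ) (hh : 0 < h) (hf : ∀ v ∈ E, |f v - a| ≤ ℓ) :
    ∃ (t : Finset ℤ) (g : X → ℤ), (t.card : ℝ) ≤ 2 * (ℓ / h) + 2 ∧ MapsTo g E t ∧
      ∀ v w, g v = g w → |f v - f w| ≤ h := by
  refine ⟨Finset.Icc ⌊-(ℓ / h)⌋ ⌊ℓ / h⌋, fun v => ⌊(f v - a) / h⌋, ?_, fun v hv => ?_,
    fun v w hvw => ?_⟩
  · have hle : ⌊-(ℓ / h)⌋ ≤ ⌊ℓ / h⌋ + 1 :=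
      (Int.floor_le_floor (neg_le_self (by positivity))).trans (by simp)
    have hcard := congrArg (Int.cast : ℤ → ℝ) (Int.card_Icc_of_le _ _ hle)
    push_cast at hcard
    linarith [Int.floor_le (ℓ / h), Int.lt_floor_add_one (-(ℓ / h))]
  · obtain ⟨hlow, hhigh⟩ := abs_le.1 (hf v hv)
    rw [Finset.coe_Icc, mem_Icc, ← neg_div]
    exact ⟨Int.floor_le_floor (by gcongr), Int.floor_le_floor (by gcongr)⟩
  · have := (Int.abs_sub_lt_one_of_floor_eq_floor hvw).le
    rwa [← sub_div, sub_sub_sub_cancel_right, abs_div, abs_of_pos hh, div_le_one hh] at this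

variable {F : Plane → Plane} {A : Plane →L[ℝ] Plane} {E : Set Plane} {η r : ℝ≥0} {d : ℝ}

theorem dist_le_of_ediam_le {X : Type*} [PseudoMetricSpace X] {s : Set X} {r : ℝ≥0}
    (hs : ediam s ≤ r) {v w : X} (hv : v ∈ s) (hw : w ∈ s) : dist v w ≤ r :=
  NNReal.coe_le_coe.2 (edist_le_coe.1 (edist_le_of_ediam_le hv hw hs))

theorem ediam_image_le_of_abs_inner_le (hF : ApproximatesLinearOn F A E η) (hE : ediam E ≤ r)
    {e : OrthonormalBasis (Fin 2) ℝ Plane} (he : ‖A (e 1)‖ ≤ η)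
    (hE0 : ∀ v ∈ E, ∀ w ∈ E, |‖A (e 0)‖ * ⟪e 0, v⟫ - ‖A (e 0)‖ * ⟪e 0, w⟫| ≤ η * r) :
    ediam (F '' E) ≤ 3 * η * r := by
  refine ediam_image_le_iff.2 fun v hv w hw => ?_
  have hvw : ‖v - w‖ ≤ r := dist_eq_norm v w ▸ dist_le_of_ediam_le hE hv hw
  have hA0 : ‖⟪e 0, v - w⟫ • A (e 0)‖ ≤ η * r := by
    rw [norm_smul, Real.norm_eq_abs, mul_comm, ← abs_of_nonneg (norm_nonneg (A (e 0))), ← abs_mul,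
      inner_sub_right, mul_sub]
    exact hE0 v hv w hw
  have hA1 : ‖⟪e 1, v - w⟫ • A (e 1)‖ ≤ η * r := by
    have h1 : |⟪e 1, v - w⟫| ≤ ‖v - w‖ := by
      simpa [e.norm_eq_one] using abs_real_inner_le_norm (e 1) (v - w)
    rw [norm_smul, Real.norm_eq_abs, mul_comm]
    gcongr
    exact h1.trans hvw
  have hA : A (v - w) = ⟪e 0, v - w⟫ • A (e 0) + ⟪e 1, v - w⟫ • A (e 1) := by
    conv_lhs => rw [← e.sum_repr' (v - w), Fin.sum_univ_two, map_add, map_smul, map_smul]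
  have hlin : ‖F v - F w - A (v - w)‖ ≤ η * r := (hF v hv w hw).trans (by gcongr)
  have hsum : F v - F w =
      F v - F w - A (v - w) + ⟪e 0, v - w⟫ • A (e 0) + ⟪e 1, v - w⟫ • A (e 1) := by
    rw [add_assoc, ← hA, sub_add_cancel]
  have hFvw : nndist (F v) (F w) ≤ 3 * η * r := by
    rw [← NNReal.coe_le_coe, coe_nndist, dist_eq_norm, hsum]
    push_cast
    linarith [norm_add₃_le (a := F v - F w - A (v - w)) (b := ⟪e 0, v - w⟫ • A (e 0))
      (c := ⟪e 1, v - w⟫ • A (e 1))]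
  exact_mod_cast edist_le_coe.2 hFvw

theorem hausdorffPremeasure_image_le_of_approximatesLinearOn (hd : 0 ≤ d)
    (hF : ApproximatesLinearOn F A E η) (hη : 0 < η) (hA : sing A 1 ≤ η) (hr : 0 < r)
    (hE : ediam E ≤ r) :
    hausdorffPremeasure d (3 * η * r) (F '' E) ≤
      ENNReal.ofReal (2 * (sing A 0 / η) + 2) * (3 * η * r) ^ d := by
  rcases E.eq_empty_or_nonempty with rfl | ⟨u, hu⟩
  · simp
  obtain ⟨e, he, -⟩ := exists_orthonormalBasis_norm_apply_eq_sing A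
  obtain ⟨t, g, ht, hgt, hg⟩ := exists_int_partition_of_abs_sub_le (E := E)
    (f := fun v => ‖A (e 0)‖ * ⟪e 0, v⟫) (a := ‖A (e 0)‖ * ⟪e 0, u⟫) (ℓ := sing A 0 * r)
    (h := η * r) (mul_nonneg (sing_nonneg A 0) r.2)
    (mul_pos (NNReal.coe_pos.2 hη) (NNReal.coe_pos.2 hr)) fun v hv => by
      rw [← mul_sub, ← inner_sub_right, abs_mul, abs_of_nonneg (norm_nonneg _), he 0]
      have h0 : |⟪e 0, v - u⟫| ≤ dist v u := by
        simpa [e.norm_eq_one, dist_eq_norm] using abs_real_inner_le_norm (e 0) (v - u)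
      exact mul_le_mul_of_nonneg_left (h0.trans (dist_le_of_ediam_le hE hv hu)) (sing_nonneg A 0)
  have hcover : F '' E ⊆ ⋃ k ∈ t, F '' (E ∩ g ⁻¹' {k}) := by
    rintro _ ⟨v, hv, rfl⟩
    exact mem_iUnion₂.2 ⟨g v, hgt hv, v, ⟨hv, rfl⟩, rfl⟩
  refine (hausdorffPremeasure_le_card_mul hd t hcover fun k _ => ?_).trans ?_
  · exact ediam_image_le_of_abs_inner_le (hF.mono_set inter_subset_left)
      ((ediam_mono inter_subset_left).trans hE) ((he 1).trans_le hA)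
      fun v hv w hw => hg v w (hv.2.trans hw.2.symm)
  · rw [mul_div_mul_right _ _ (NNReal.coe_ne_zero.2 hr.ne')] at ht
    gcongr
    exact (ENNReal.ofReal_natCast _).symm.trans_le (ENNReal.ofReal_le_ofReal ht)

end NearlyLinearMaps

section Cocycle

theorem contDiff_iterate {𝕜 V : Type*} [NontriviallyNormedField 𝕜] [NormedAddCommGroup V]
    [NormedSpace 𝕜 V] {n : WithTop ℕ∞} {F : V → V} (hF : ContDiff 𝕜 n F) (k : ℕ) :
    ContDiff 𝕜 n F^[k] := by
  induction k with
  | zero => exact contDiff_id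
  | succ k ih =>
    rw [Function.iterate_succ']
    exact hF.comp ih

variable {φ : Plane → Plane}

theorem fundamental_eq_fderiv_iterate (hφ : Differentiable ℝ φ) (t : ℕ) (u : Plane) :
    fundamental φ t u = fderiv ℝ φ^[t] u := by
  induction t with
  | zero => exact fderiv_id.symm
  | succ t ih =>
    rw [Function.iterate_succ', fderiv_comp _ (hφ _) ((hφ.iterate t) _), fundamental, ih]

theorem apply_fundamental_le_pow {K : Set Plane} (hK : MapsTo φ K K)
    {p : (Plane →L[ℝ] Plane) → ℝ} (hp : ∀ A, 0 ≤ p A) (hp_id : p (.id ℝ Plane) ≤ 1)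
    (hp_comp : ∀ A B, p (A.comp B) ≤ p A * p B) {C : ℝ} (hC : ∀ u ∈ K, p (fderiv ℝ φ u) ≤ C)
    (t : ℕ) {u : Plane} (hu : u ∈ K) : p (fundamental φ t u) ≤ C ^ t := by
  have hC0 : 0 ≤ C := (hp _).trans (hC u hu)
  induction t with
  | zero => simpa [fundamental] using hp_id
  | succ t ih =>
    calc p (fundamental φ (t + 1) u)
        ≤ p (fderiv ℝ φ (φ^[t] u)) * p (fundamental φ t u) := hp_comp _ _
      _ ≤ C * C ^ t := mul_le_mul (hC _ (hK.iterate t hu)) ih (hp _) hC0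
      _ = C ^ (t + 1) := (pow_succ' C t).symm

end Cocycle

section DouadyOesterle

theorem exists_cutoff_count_mul_rpow_le_one {d : ℝ} (hd : 1 < d) (L : ℝ) :
    ∃ ε : ℝ≥0, 0 < ε ∧ ∀ s q : ℝ≥0, q ≤ s → s ≤ L → 4 * 6 ^ d * (s * q ^ (d - 1)) ≤ (1 : ℝ) →
      (2 * (s / (max q ε : ℝ≥0)) + 2) * (6 * (max q ε : ℝ≥0)) ^ d ≤ (1 : ℝ) := by
  have htendsto : Tendsto (fun ε : ℝ≥0 => 2 * 6 ^ d * ((L + ε) * (ε : ℝ) ^ (d - 1))) (𝓝[>] 0)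
      (𝓝 0) := by
    have hcont : Continuous fun ε : ℝ≥0 => 2 * 6 ^ d * ((L + ε) * (ε : ℝ) ^ (d - 1)) := by
      have := (NNReal.continuous_coe.rpow_const (p := d - 1) fun _ => .inr (by linarith))
      fun_prop
    simpa [Real.zero_rpow (sub_pos.2 hd).ne'] using
      (hcont.continuousWithinAt (s := Ioi 0) (x := 0)).tendsto
  obtain ⟨ε, hεL, hε⟩ := ((htendsto.eventually_le_const one_pos).and
    self_mem_nhdsWithin).exists
  refine ⟨ε, hε, fun s q hqs hsL hsq => ?_⟩
  have count_mul_rpow : ∀ η : ℝ≥0, 0 < η →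
      (2 * ((s : ℝ) / η) + 2) * (6 * η) ^ d = 2 * 6 ^ d * ((s + η) * (η : ℝ) ^ (d - 1)) := by
    intro η hη
    have hη' : (0 : ℝ) < η := hη
    rw [Real.mul_rpow (by norm_num) hη'.le, Real.rpow_sub_one hη'.ne']
    field_simp
  rw [count_mul_rpow _ (lt_max_of_lt_right hε)]
  rcases le_total q ε with hqε | hεq
  · rw [max_eq_right hqε]
    refine le_trans ?_ hεL
    gcongr
  · rw [max_eq_left hεq]
    calc 2 * 6 ^ d * (((s : ℝ) + q) * (q : ℝ) ^ (d - 1))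
        ≤ 2 * 6 ^ d * ((s + s) * (q : ℝ) ^ (d - 1)) := by gcongr
      _ = 4 * 6 ^ d * (s * (q : ℝ) ^ (d - 1)) := by ring
      _ ≤ 1 := hsq

variable {F : Plane → Plane} {K : Set Plane}

theorem hausdorffPremeasure_half_image_le {A : Plane →L[ℝ] Plane} {E : Set Plane} {η : ℝ≥0}
    {d : ℝ} (hd : 0 < d) (hF : ApproximatesLinearOn F A E η) (hη : 0 < η) (hA : sing A 1 ≤ η)
    (hcount : (2 * (sing A 0 / η) + 2) * (6 * η) ^ d ≤ (1 : ℝ)) (hE : ediam E ≠ ∞) :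
    hausdorffPremeasure d (2⁻¹ * ediam E) (F '' E) ≤ (2⁻¹ * ediam E) ^ d := by
  rcases E.subsingleton_or_nontrivial with hsub | hnt
  · exact hausdorffPremeasure_le_of_ediam_le hd.le
      ((hsub.image F).ediam_eq.trans_le zero_le) le_rfl
  lift ediam E to ℝ≥0 using hE with r hr
  have hr0 : 0 < r := ENNReal.coe_pos.1 (hr ▸ ediam_pos_iff.2 hnt)
  have h6 : (6 * η : ℝ≥0) ≤ 1 := by
    have hN : 1 ≤ 2 * (sing A 0 / η) + 2 := by
      linarith [div_nonneg (sing_nonneg A 0) η.coe_nonneg]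
    by_contra! hlt
    have := Real.one_lt_rpow (x := 6 * η) (by exact_mod_cast hlt) hd
    nlinarith
  have hcut : 3 * (η : ℝ≥0∞) * r = 6 * η * (2⁻¹ * r) := by
    have h2 : (6 : ℝ≥0∞) * 2⁻¹ = 3 := by
      rw [show (6 : ℝ≥0∞) = 3 * 2 by norm_num, mul_assoc,
        ENNReal.mul_inv_cancel two_ne_zero ENNReal.ofNat_ne_top, mul_one]
    rw [← h2]
    ring
  have hcount' : ENNReal.ofReal (2 * (sing A 0 / η) + 2) * (6 * η) ^ d ≤ 1 := by
    have h6η : (6 * η : ℝ≥0∞) = ENNReal.ofReal (6 * η) := by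
      rw [ENNReal.ofReal_mul (by norm_num), ENNReal.ofReal_coe_nnreal, ENNReal.ofReal_ofNat]
    rw [h6η, ENNReal.ofReal_rpow_of_nonneg (by positivity) hd.le,
      ← ENNReal.ofReal_mul (by have := sing_nonneg A 0; positivity)]
    exact ENNReal.ofReal_le_one.2 hcount
  calc hausdorffPremeasure d (2⁻¹ * r) (F '' E)
      ≤ hausdorffPremeasure d (3 * η * r) (F '' E) := by
        refine OuterMeasure.mkMetric'.mono_pre _ ?_ _
        rw [hcut]
        exact mul_le_of_le_one_left' (by exact_mod_cast h6)
    _ ≤ ENNReal.ofReal (2 * (sing A 0 / η) + 2) * (3 * η * r) ^ d :=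
        hausdorffPremeasure_image_le_of_approximatesLinearOn hd.le hF hη hA hr0 hr.ge
    _ = ENNReal.ofReal (2 * (sing A 0 / η) + 2) * (6 * η) ^ d * (2⁻¹ * r) ^ d := by
        rw [hcut, ENNReal.mul_rpow_of_nonneg _ _ hd.le, mul_assoc]
    _ ≤ (2⁻¹ * r) ^ d := mul_le_of_le_one_left' hcount'

theorem dimH_le_of_singularValueFunction_fderiv_le (hK : IsCompact K) (hF : ContDiff ℝ 1 F)
    (hKF : K ⊆ F '' K) {d : ℝ≥0} (hd : 1 < d)
    (h : ∀ u ∈ K, 4 * 6 ^ (d : ℝ) * singularValueFunction d (fderiv ℝ F u) ≤ 1) :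
    dimH K ≤ d := by
  obtain ⟨L, hL⟩ := hK.exists_bound_of_continuousOn
    (hF.continuous_fderiv one_ne_zero).continuousOn
  obtain ⟨ε, hε, hcount⟩ := exists_cutoff_count_mul_rpow_le_one (NNReal.one_lt_coe.2 hd) L
  obtain ⟨δ, hδ, happ⟩ := exists_approximatesLinearOn_of_isCompact hK
    (fun u _ => hF.contDiffAt.hasStrictFDerivAt one_ne_zero) hε
  refine dimH_le_of_hausdorffPremeasure_image_le (one_pos.trans hd) hK hKF
    (ENNReal.inv_ne_zero.2 ENNReal.ofNat_ne_top) ENNReal.one_half_lt_one hδ fun E hE hEδ => ?_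
  rcases E.eq_empty_or_nonempty with rfl | hne
  · simp
  obtain ⟨u, hu, hEu⟩ := happ E hE hne hEδ
  set A := fderiv ℝ F u
  let q : ℝ≥0 := ⟨sing A 1, sing_nonneg A 1⟩
  have hq : sing A 1 ≤ (max q ε : ℝ≥0) := NNReal.coe_le_coe.2 (le_max_left q ε)
  have hcount_q : (2 * (sing A 0 / (max q ε : ℝ≥0)) + 2) * (6 * (max q ε : ℝ≥0)) ^ (d : ℝ) ≤
      (1 : ℝ) :=
    hcount ⟨sing A 0, sing_nonneg A 0⟩ q (sing_one_le_sing_zero A)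
      ((sing_zero_eq_norm A).trans_le (hL u hu)) (h u hu)
  exact hausdorffPremeasure_half_image_le (one_pos.trans hd) (hEu.mono_num (le_max_right q ε))
    (lt_max_of_lt_right hε) hq hcount_q (hK.isBounded.subset hE).ediam_ne_top

theorem dimH_le_of_singularValueFunction_fderiv_lt_one (hK : IsCompact K) (hF : ContDiff ℝ 1 F)
    (hmaps : MapsTo F K K) (hsurj : SurjOn F K K) {d : ℝ≥0} (hd1 : 1 < d) (hd2 : d ≤ 2)
    (h : ∀ u ∈ K, singularValueFunction d (fderiv ℝ F u) < 1) : dimH K ≤ d := by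
  rcases K.eq_empty_or_nonempty with rfl | hne
  · simp
  have hd1' : (1 : ℝ) ≤ d := hd1.le
  have hd2' : (d : ℝ) ≤ 2 := hd2
  obtain ⟨u₀, hu₀, hmax⟩ := hK.exists_isMaxOn hne
    ((continuous_singularValueFunction hd1' hd2').comp
      (hF.continuous_fderiv one_ne_zero)).continuousOn
  set κ := singularValueFunction d (fderiv ℝ F u₀)
  have hpos : (0 : ℝ) < 4 * 6 ^ (d : ℝ) := by positivity
  obtain ⟨k, hk⟩ := exists_pow_lt_of_lt_one (inv_pos.2 hpos) (h u₀ hu₀)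
  refine dimH_le_of_singularValueFunction_fderiv_le hK (contDiff_iterate hF k) (hsurj.iterate k) hd1
    fun u hu => ?_
  rw [← fundamental_eq_fderiv_iterate (hF.differentiable one_ne_zero), ← le_inv_mul_iff₀ hpos,
    mul_one]
  exact (apply_fundamental_le_pow hmaps (singularValueFunction_nonneg d)
    (singularValueFunction_id hd1' hd2').le (singularValueFunction_comp_le hd1' hd2') hmax k
    hu).trans hk.le

end DouadyOesterle

section KaplanYorke

theorem kaplanYorke_two (l : ℕ → ℝ) :
    kaplanYorke 2 l =
      if 0 ≤ l 0 + l 1 then 2 else if 0 ≤ l 0 then 1 + l 0 / |l 1| else 0 := by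
  unfold kaplanYorke
  have hindex : kaplanYorkeIndex 2 l = if 0 ≤ l 0 + l 1 then 2 else if 0 ≤ l 0 then 1 else 0 := by
    simp [kaplanYorkeIndex, Nat.findGreatest, Finset.sum_range_succ]
  rw [hindex]
  split_ifs <;> simp_all

variable {l : ℕ → ℝ}

theorem neg_of_kaplanYorke_two_lt_one (h : kaplanYorke 2 l < 1) : l 0 < 0 := by
  rw [kaplanYorke_two] at h
  split_ifs at h with hsum h0
  · norm_num at h
  · have : 0 ≤ l 0 / |l 1| := by positivity
    linarith
  · exact not_le.1 h0

theorem add_mul_neg_of_kaplanYorke_two_lt {d : ℝ} (hd1 : 1 < d) (hd2 : d ≤ 2)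
    (h : kaplanYorke 2 l < d) : l 0 + (d - 1) * l 1 < 0 := by
  rw [kaplanYorke_two] at h
  split_ifs at h with hsum h0
  · linarith
  · have hl1 : l 1 < 0 := by linarith
    have := (div_lt_iff₀ (abs_pos_of_neg hl1)).1 (lt_sub_iff_add_lt'.2 h)
    rw [abs_of_neg hl1] at this
    linarith
  · calc l 0 + (d - 1) * l 1 = (2 - d) * l 0 + (d - 1) * (l 0 + l 1) := by ring
      _ < 0 := add_neg_of_nonpos_of_neg
        (mul_nonpos_of_nonneg_of_nonpos (sub_nonneg.2 hd2) (not_le.1 h0).le)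
        (mul_neg_of_pos_of_neg (sub_pos.2 hd1) (not_le.1 hsum))

theorem kaplanYorke_two_le {Λ β : ℝ} (hl0 : l 0 ≤ Λ) (hsum : l 0 + l 1 ≤ -β) (hΛ : 0 ≤ Λ)
    (hβ : 0 < β) : kaplanYorke 2 l ≤ 1 + Λ / (Λ + β) := by
  have hpos : 0 ≤ 1 + Λ / (Λ + β) := by positivity
  rw [kaplanYorke_two, if_neg (by linarith)]
  split_ifs with h0
  · rw [abs_of_neg (by linarith)]
    calc 1 + l 0 / -l 1 ≤ 1 + l 0 / (l 0 + β) := by gcongr; linarith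
      _ ≤ 1 + Λ / (Λ + β) := by
        gcongr 1 + ?_
        rw [div_le_div_iff₀ (by linarith) (by linarith)]
        nlinarith
  · exact hpos

end KaplanYorke

section LyapunovDimension

variable {φ : Plane → Plane} {t : ℕ} {u : Plane}

theorem norm_fundamental_lt_one_of_localLyapunovDim_lt_one (h : localLyapunovDim φ t u < 1) :
    ‖fundamental φ t u‖ < 1 := by
  rw [← sing_zero_eq_norm]
  by_contra! hle
  exact (neg_of_kaplanYorke_two_lt_one h).not_ge
    (mul_nonneg (by positivity) (Real.log_nonneg hle))

theorem singularValueFunction_fundamental_lt_one_of_localLyapunovDim_lt {d : ℝ} (hd1 : 1 < d)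
    (hd2 : d ≤ 2) (h : localLyapunovDim φ t u < d) :
    singularValueFunction d (fundamental φ t u) < 1 := by
  have hneg := add_mul_neg_of_kaplanYorke_two_lt hd1 hd2 h
  rcases (sing_nonneg (fundamental φ t u) 1).eq_or_lt with h1 | h1
  · rw [singularValueFunction, ← h1, Real.zero_rpow (sub_pos.2 hd1).ne', mul_zero]
    exact one_pos
  have h0 := h1.trans_le (sing_one_le_sing_zero _)
  have hω : Real.log (singularValueFunction d (fundamental φ t u)) =
      Real.log (sing (fundamental φ t u) 0) + (d - 1) * Real.log (sing (fundamental φ t u) 1) := by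
    rw [singularValueFunction, Real.log_mul h0.ne' (Real.rpow_pos_of_pos h1 _).ne',
      Real.log_rpow h1]
  have hpos : 0 < singularValueFunction d (fundamental φ t u) :=
    mul_pos h0 (Real.rpow_pos_of_pos h1 _)
  rw [← Real.log_neg_iff hpos, hω]
  refine neg_of_mul_neg_right (?_ : 1 / (t : ℝ) * _ < 0) (by positivity)
  unfold lyapunovExponent at hneg
  linarith

variable {K : Set Plane}

namespace IsBoundedInvariant

theorem isCompact (hK : IsBoundedInvariant φ K) : IsCompact K :=
  isCompact_of_isClosed_isBounded hK.isClosed hK.isBounded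

theorem mapsTo (hK : IsBoundedInvariant φ K) : MapsTo φ K K :=
  mapsTo_iff_image_subset.2 (hK.image_iterate 1).subset

theorem surjOn (hK : IsBoundedInvariant φ K) : SurjOn φ K K :=
  (hK.image_iterate 1).superset

end IsBoundedInvariant

theorem dimH_le_of_localLyapunovDim_lt (hφ : ContDiff ℝ 1 φ) (hK : IsBoundedInvariant φ K)
    {c : ℝ≥0} (h : ∀ u ∈ K, localLyapunovDim φ t u < c) : dimH K ≤ c := by
  have hfund := fundamental_eq_fderiv_iterate (hφ.differentiable one_ne_zero) t
  rcases le_or_gt c 1 with hc1 | hc1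
  · refine (dimH_eq_zero_of_norm_fderiv_lt_one hK.isCompact (contDiff_iterate hφ t)
      (hK.surjOn.iterate t) fun u hu => ?_).trans_le zero_le
    rw [← hfund]
    exact norm_fundamental_lt_one_of_localLyapunovDim_lt_one ((h u hu).trans_le hc1)
  rcases le_or_gt c 2 with hc2 | hc2
  · refine dimH_le_of_singularValueFunction_fderiv_lt_one hK.isCompact (contDiff_iterate hφ t)
      (hK.mapsTo.iterate t) (hK.surjOn.iterate t) hc1 hc2 fun u hu => ?_
    rw [← hfund]
    exact singularValueFunction_fundamental_lt_one_of_localLyapunovDim_lt hc1 hc2 (h u hu)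
  · calc dimH K ≤ dimH (univ : Set Plane) := dimH_mono (subset_univ K)
      _ = 2 := by rw [Real.dimH_univ_eq_finrank, finrank_plane, Nat.cast_ofNat]
      _ ≤ c := by exact_mod_cast hc2.le

theorem dimH_le_lyapunovDim (hφ : ContDiff ℝ 1 φ) (hK : IsBoundedInvariant φ K) :
    dimH K ≤ lyapunovDim φ K := by
  refine le_of_forall_gt_imp_ge_of_dense fun c hc => ?_
  rcases eq_or_ne c ∞ with rfl | hc_top
  · exact le_top
  lift c to ℝ≥0 using hc_top
  obtain ⟨t, ht⟩ := (frequently_lt_of_liminf_lt (by isBoundedDefault) hc).exists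
  refine dimH_le_of_localLyapunovDim_lt (t := t) hφ hK fun u hu => ?_
  have hlt : ENNReal.ofReal (localLyapunovDim φ t u) < c :=
    (le_iSup₂ (f := fun v (_ : v ∈ K) => ENNReal.ofReal (localLyapunovDim φ t v)) u hu).trans_lt ht
  rw [← ENNReal.ofReal_coe_nnreal] at hlt
  exact (ENNReal.ofReal_lt_ofReal_iff'.1 hlt).1

theorem lyapunovExponent_zero_add_one (hdet : (fundamental φ t u).det ≠ 0) :
    lyapunovExponent φ t u 0 + lyapunovExponent φ t u 1 =
      1 / (t : ℝ) * Real.log |(fundamental φ t u).det| := by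
  have hsing := sing_zero_mul_sing_one (fundamental φ t u)
  have hne := hsing.trans_ne (abs_ne_zero.2 hdet)
  rw [← hsing, Real.log_mul (left_ne_zero_of_mul hne) (right_ne_zero_of_mul hne), mul_add]
  rfl

theorem one_div_mul_log_le_log_of_le_pow {x C : ℝ} (hx : 0 < x) (ht : t ≠ 0) (h : x ≤ C ^ t) :
    1 / (t : ℝ) * Real.log x ≤ Real.log C := by
  rw [one_div, inv_mul_le_iff₀ (by positivity), ← Real.log_pow]
  exact Real.log_le_log hx h

theorem det_fundamental_ne_zero (hK : MapsTo φ K K) (hdet : ∀ u ∈ K, (fderiv ℝ φ u).det ≠ 0)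
    (t : ℕ) (hu : u ∈ K) : (fundamental φ t u).det ≠ 0 := by
  induction t with
  | zero => exact (LinearMap.det_id (M := Plane)).trans_ne one_ne_zero
  | succ t ih =>
    exact (LinearMap.det_comp _ _).trans_ne (mul_ne_zero (hdet _ (hK.iterate t hu)) ih)

theorem lyapunovDim_le (hK : MapsTo φ K K) {L D : ℝ} (hL : 1 ≤ L) (hD : D < 1)
    (hnorm : ∀ u ∈ K, ‖fderiv ℝ φ u‖ ≤ L) (hdet0 : ∀ u ∈ K, (fderiv ℝ φ u).det ≠ 0)
    (hdet : ∀ u ∈ K, |(fderiv ℝ φ u).det| ≤ D) :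
    lyapunovDim φ K ≤ ENNReal.ofReal (1 + Real.log L / (Real.log L - Real.log D)) := by
  have finiteTime_le : ∀ᶠ t in atTop, finiteTimeLyapunovDim φ t K ≤
      ENNReal.ofReal (1 + Real.log L / (Real.log L - Real.log D)) := by
    filter_upwards [eventually_ne_atTop 0] with t ht
    refine iSup₂_le fun u hu => ENNReal.ofReal_le_ofReal ?_
    have hdet_ne := det_fundamental_ne_zero hK hdet0 t hu
    have hdet_le : |(fundamental φ t u).det| ≤ D ^ t :=
      apply_fundamental_le_pow hK (p := fun A => |A.det|) (fun A => abs_nonneg _)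
        ((congrArg abs (LinearMap.det_id (M := Plane))).trans abs_one).le
        (fun A B => ((congrArg abs (LinearMap.det_comp _ _)).trans (abs_mul _ _)).le) hdet t hu
    have hnorm_le : ‖fundamental φ t u‖ ≤ L ^ t :=
      apply_fundamental_le_pow hK norm_nonneg (ContinuousLinearMap.norm_id_le)
        ContinuousLinearMap.opNorm_comp_le hnorm t hu
    have hD0 : 0 < D := (abs_pos.2 (hdet0 u hu)).trans_le (hdet u hu)
    have hsing0 : 0 < sing (fundamental φ t u) 0 := (sing_nonneg _ 0).lt_of_ne' <|
      left_ne_zero_of_mul ((sing_zero_mul_sing_one _).trans_ne (abs_ne_zero.2 hdet_ne))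
    refine kaplanYorke_two_le (β := -Real.log D)
      (one_div_mul_log_le_log_of_le_pow hsing0 ht ((sing_zero_eq_norm _).trans_le hnorm_le)) ?_
      (Real.log_nonneg hL) (neg_pos.2 (Real.log_neg hD0 hD))
    rw [lyapunovExponent_zero_add_one hdet_ne, neg_neg]
    exact one_div_mul_log_le_log_of_le_pow (abs_pos.2 hdet_ne) ht hdet_le
  exact (liminf_le_liminf finiteTime_le).trans_eq (liminf_const _)

end LyapunovDimension

section HenonDerivative

/-- The Jacobian of the Hénon map at `u`; it does not depend on `a`. -/
noncomputable def henonDeriv (b : ℝ) (u : Plane) : Plane →L[ℝ] Plane :=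
  Matrix.toEuclideanCLM (𝕜 := ℝ) !![-(2 * u 0), b; 1, 0]

theorem henonDeriv_apply (b : ℝ) (u v : Plane) :
    henonDeriv b u v = !₂[-(2 * u 0) * v 0 + b * v 1, v 0] := by
  ext i
  fin_cases i <;>
    simp [henonDeriv, Matrix.ofLp_toEuclideanCLM, Matrix.mulVec, dotProduct, Fin.sum_univ_two]

theorem hasFDerivAt_henonMap (a b : ℝ) (u : Plane) :
    HasFDerivAt (henonMap a b) (henonDeriv b u) u := by
  have hcoord (i : Fin 2) : HasStrictFDerivAt (fun v : Plane => v i)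
      (EuclideanSpace.proj i : Plane →L[ℝ] ℝ) u :=
    (EuclideanSpace.proj i : Plane →L[ℝ] ℝ).hasStrictFDerivAt
  refine (hasStrictFDerivAt_euclidean.2 fun i => ?_).hasFDerivAt
  fin_cases i
  · refine ((((hcoord 1).const_mul b).const_add a).sub ((hcoord 0).pow 2)).congr_fderiv ?_
    ext v
    simp [henonDeriv_apply]
    ring
  · refine (hcoord 0).congr_fderiv ?_
    ext v
    simp [henonDeriv_apply]

theorem fderiv_henonMap (a b : ℝ) (u : Plane) : fderiv ℝ (henonMap a b) u = henonDeriv b u :=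
  (hasFDerivAt_henonMap a b u).fderiv

theorem contDiff_henonMap (a b : ℝ) {n : WithTop ℕ∞} : ContDiff ℝ n (henonMap a b) := by
  have hcoord (i : Fin 2) : ContDiff ℝ n fun v : Plane => v i :=
    (EuclideanSpace.proj i : Plane →L[ℝ] ℝ).contDiff
  refine contDiff_euclidean.2 fun i => ?_
  fin_cases i
  · exact (contDiff_const.add (contDiff_const.mul (hcoord 1))).sub ((hcoord 0).pow 2)
  · exact hcoord 0

theorem det_henonDeriv (b : ℝ) (u : Plane) : (henonDeriv b u).det = -b := by
  have hdet : (henonDeriv b u).det = Matrix.det !![-(2 * u 0), b; 1, 0] :=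
    LinearMap.det_toLin (EuclideanSpace.basisFun (Fin 2) ℝ).toBasis _
  simpa [Matrix.det_fin_two_of] using hdet

theorem sing_zero_henonDeriv (b : ℝ) (u : Plane) : sing (henonDeriv b u) 0 = sigmaOne b (u 0) := by
  have hcols : ‖henonDeriv b u (EuclideanSpace.basisFun (Fin 2) ℝ 0)‖ ^ 2 +
      ‖henonDeriv b u (EuclideanSpace.basisFun (Fin 2) ℝ 1)‖ ^ 2 = 4 * u 0 ^ 2 + 1 + |b| ^ 2 := by
    simp [EuclideanSpace.norm_sq_eq, Fin.sum_univ_two, henonDeriv_apply]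
    ring
  rw [sing_zero_eq_half_sqrt_add_sqrt _ (EuclideanSpace.basisFun (Fin 2) ℝ), hcols,
    det_henonDeriv, abs_neg, sigmaOne]
  congr! 3 <;> ring

theorem one_le_sigmaOne (b x : ℝ) : 1 ≤ sigmaOne b x := by
  have hadd : 1 + |b| ≤ √(4 * x ^ 2 + (1 + |b|) ^ 2) :=
    Real.le_sqrt_of_sq_le (by nlinarith [sq_nonneg x])
  have hsub : 1 - |b| ≤ √(4 * x ^ 2 + (1 - |b|) ^ 2) :=
    Real.le_sqrt_of_sq_le (by nlinarith [sq_nonneg x])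
  unfold sigmaOne
  linarith

theorem one_lt_sigmaOne (b : ℝ) {x : ℝ} (hx : x ≠ 0) : 1 < sigmaOne b x := by
  have hx2 : 0 < x ^ 2 := by positivity
  have hadd : 1 + |b| < √(4 * x ^ 2 + (1 + |b|) ^ 2) := Real.lt_sqrt_of_sq_lt (by linarith)
  have hsub : 1 - |b| < √(4 * x ^ 2 + (1 - |b|) ^ 2) := Real.lt_sqrt_of_sq_lt (by linarith)
  unfold sigmaOne
  linarith

theorem sigmaOne_le_sigmaOne {b x y : ℝ} (h : |x| ≤ |y|) : sigmaOne b x ≤ sigmaOne b y := by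
  have := sq_le_sq.2 h
  unfold sigmaOne
  gcongr

theorem sing_one_henonDeriv (b : ℝ) (u : Plane) :
    sing (henonDeriv b u) 1 = |b| / sigmaOne b (u 0) := by
  have hσ := one_le_sigmaOne b (u 0)
  rw [eq_div_iff (by positivity), ← sing_zero_henonDeriv, mul_comm, sing_zero_mul_sing_one,
    det_henonDeriv, abs_neg]

end HenonDerivative

section HenonDimension

variable {a b : ℝ} {K : Set Plane}

theorem lyapunovDim_henonMap_le (hb0 : b ≠ 0) (hb1 : |b| < 1)
    (hK : MapsTo (henonMap a b) K K) {X : ℝ} (hX : ∀ u ∈ K, |u 0| ≤ X) :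
    lyapunovDim (henonMap a b) K ≤
      ENNReal.ofReal (1 + Real.log (sigmaOne b X) / (Real.log (sigmaOne b X) - Real.log |b|)) := by
  have hdet (u : Plane) : (fderiv ℝ (henonMap a b) u).det = -b := by
    rw [fderiv_henonMap, det_henonDeriv]
  refine lyapunovDim_le hK (one_le_sigmaOne b X) hb1 (fun u hu => ?_)
    (fun u _ => (hdet u).trans_ne (neg_ne_zero.2 hb0)) fun u _ => ?_
  · rw [fderiv_henonMap, ← sing_zero_eq_norm, sing_zero_henonDeriv]
    exact sigmaOne_le_sigmaOne ((hX u hu).trans (le_abs_self X))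
  · rw [hdet, abs_neg]

end HenonDimension

section Localization

variable {a b : ℝ} {K : Set Plane} {u : Plane}

theorem exists_forall_fst_le {φ : Plane → Plane} (hK : IsBoundedInvariant φ K) :
    ∃ z ∈ K, ∀ v ∈ K, v 0 ≤ z 0 := by
  obtain ⟨z, hz, hmax⟩ := hK.isCompact.exists_isMaxOn hK.nonempty (f := fun v => v 0)
    (by fun_prop)
  exact ⟨z, hz, fun v hv => hmax hv⟩

theorem exists_fst_eq (hK : SurjOn (henonMap a b) K K) (hu : u ∈ K) :
    ∃ v ∈ K, u 0 = a + b * v 0 - henonMap a b v 0 ^ 2 := by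
  obtain ⟨v, hv, rfl⟩ := (hK.comp hK) hu
  exact ⟨v, hv, rfl⟩

theorem snd_le_of_forall_fst_le (hK : SurjOn (henonMap a b) K K) {M : ℝ} (hM : ∀ v ∈ K, v 0 ≤ M)
    (hu : u ∈ K) : u 1 ≤ M := by
  obtain ⟨v, hv, rfl⟩ := hK hu
  exact hM v hv

theorem fst_le_div (hb0 : 0 ≤ b) (hb1 : b < 1) (hK : IsBoundedInvariant (henonMap a b) K)
    (hu : u ∈ K) : u 0 ≤ a / (1 - b) := by
  obtain ⟨z, hz, hmax⟩ := exists_forall_fst_le hK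
  obtain ⟨v, hv, hz_eq⟩ := exists_fst_eq hK.surjOn hz
  refine (hmax u hu).trans ((le_div_iff₀ (sub_pos.2 hb1)).2 ?_)
  linarith [mul_le_mul_of_nonneg_left (hmax v hv) hb0, sq_nonneg (henonMap a b v 0)]

theorem mul_fst_le (hb : 0 ≤ b) {c : ℝ} (hc : 0 < c) (hbc : 2 * c * b ≤ 1)
    (hK : IsBoundedInvariant (henonMap a b) K) (hu : u ∈ K) :
    (1 - 2 * c * b) * u 0 ≤ a * (1 + 2 * c) + c ^ 2 + b ^ 2 / (8 * c) := by
  obtain ⟨z, hz, hmax⟩ := exists_forall_fst_le hK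
  obtain ⟨v, hv, hz_eq⟩ := exists_fst_eq hK.surjOn hz
  have hw : 2 * c * henonMap a b v 0 ≤ 2 * c * (a + b * z 0 - v 0 ^ 2) := by
    have hv1 := snd_le_of_forall_fst_le hK.surjOn hmax hv
    change 2 * c * (a + b * v 1 - v 0 ^ 2) ≤ _
    gcongr
  have tangent_le : -henonMap a b v 0 ^ 2 ≤ 2 * c * henonMap a b v 0 + c ^ 2 := by
    linarith [sq_nonneg (henonMap a b v 0 + c)]
  have parabola_le : b * v 0 - 2 * c * v 0 ^ 2 ≤ b ^ 2 / (8 * c) := by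
    rw [le_div_iff₀ (by positivity)]
    linarith [sq_nonneg (4 * c * v 0 - b)]
  calc (1 - 2 * c * b) * u 0 ≤ (1 - 2 * c * b) * z 0 :=
        mul_le_mul_of_nonneg_left (hmax u hu) (sub_nonneg.2 hbc)
    _ ≤ a * (1 + 2 * c) + c ^ 2 + b ^ 2 / (8 * c) := by linarith

theorem feitR_sq (ha : 0 ≤ 1 + 4 * a) : feitR a ^ 2 = a - feitR a := by
  unfold feitR
  linarith [Real.sq_sqrt ha]

theorem feitR_neg (a : ℝ) : feitR a < 0 := by
  unfold feitR
  linarith [Real.sqrt_nonneg (1 + 4 * a)]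

theorem feitR_le_fst_of_snd_nonpos (ha : 0 ≤ 1 + 4 * a) (hb : 0 ≤ b)
    (hK : IsBoundedInvariant (henonMap a b) K) (hu : u ∈ K) (hu1 : u 1 ≤ 0) : feitR a ≤ u 0 := by
  have hcompact : IsCompact (K ∩ {v | v 1 ≤ 0}) :=
    hK.isCompact.inter_right (isClosed_le (by fun_prop) continuous_const)
  obtain ⟨z, ⟨hzK, hz1⟩, hmin⟩ := hcompact.exists_isMinOn ⟨u, hu, hu1⟩ (f := fun v => v 0)
    (by fun_prop)
  refine le_trans ?_ (hmin ⟨hu, hu1⟩)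
  by_contra! hzr
  have hz0 : z 0 < 0 := hzr.trans (feitR_neg a)
  have hle : z 0 ≤ a + b * z 1 - z 0 ^ 2 := hmin ⟨hK.mapsTo hzK, hz0.le⟩
  have hsq : feitR a ^ 2 + feitR a < z 0 ^ 2 + z 0 := by
    have : feitR a ≤ -1 / 2 := by
      unfold feitR
      linarith [Real.sqrt_nonneg (1 + 4 * a)]
    nlinarith
  linarith [feitR_sq ha, mul_nonpos_of_nonneg_of_nonpos hb hz1]

theorem neg_le_fst (ha : 0 ≤ 1 + 4 * a) (hb : 0 ≤ b) (hK : IsBoundedInvariant (henonMap a b) K)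
    {M s : ℝ} (hM : ∀ v ∈ K, v 0 ≤ M) (hs : 0 ≤ s) (hMs : a + b * M ≤ s ^ 2)
    (hr : a - b * s - (s ^ 2 - a - b * M) ^ 2 ≤ feitR a) (hu : u ∈ K) : -s ≤ u 0 := by
  by_contra! hus
  have hu1 : b * u 1 ≤ b * M :=
    mul_le_mul_of_nonneg_left (snd_le_of_forall_fst_le hK.surjOn hM hu) hb
  have hv0 : henonMap a b u 0 < a + b * M - s ^ 2 := by
    change a + b * u 1 - u 0 ^ 2 < _
    nlinarith
  have hz0 : henonMap a b (henonMap a b u) 0 < feitR a := by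
    change a + b * u 0 - henonMap a b u 0 ^ 2 < _
    have : b * u 0 ≤ b * -s := mul_le_mul_of_nonneg_left hus.le hb
    nlinarith
  have hv := hK.mapsTo hu
  exact hz0.not_ge <| feitR_le_fst_of_snd_nonpos ha hb hK (hK.mapsTo hv)
    (hv0.le.trans (by linarith))

theorem feitRadius_pos (a b : ℝ) : 0 < feitRadius a b :=
  lt_max_of_lt_left (neg_pos.2 (feitR_neg a))

theorem abs_fst_le_feitRadius (ha : 0 ≤ a) (hb0 : 0 ≤ b) (hb1 : b < 1)
    (hK : IsBoundedInvariant (henonMap a b) K) (hu : u ∈ K) : |u 0| ≤ feitRadius a b := by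
  have hM (v : Plane) (hv : v ∈ K) : v 0 ≤ feitM a b := by
    refine (fst_le_div hb0 hb1 hK hv).trans ?_
    have : 0 ≤ 1 - b := by linarith
    unfold feitM
    gcongr
    nlinarith
  have hradius := (feitRadius_pos a b).le
  have hsq : b * (feitM a b + a) + a - feitR a ≤ feitRadius a b ^ 2 :=
    (Real.sqrt_le_left hradius).1 (le_max_of_le_right (le_max_right _ _))
  have hba : 0 ≤ b * a := mul_nonneg hb0 ha
  have hr := feitR_neg a
  refine abs_le.2 ⟨neg_le_fst (by linarith) hb0 hK hM hradius (by linarith) ?_ hu,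
    (hM u hu).trans (le_max_of_le_right (le_max_left _ _))⟩
  have hr2 : feitR a ^ 2 ≤ (feitRadius a b ^ 2 - a - b * feitM a b) ^ 2 :=
    sq_le_sq' (by linarith) (by linarith)
  linarith [feitR_sq (a := a) (by linarith), mul_nonneg hb0 hradius]

end Localization

section ClassicalParameters

variable {K : Set Plane} {u : Plane}

theorem abs_fst_le_of_classical (hK : IsBoundedInvariant (henonMap 1.4 0.3) K) (hu : u ∈ K) :
    |u 0| ≤ 1.89 := by
  have hM (v : Plane) (hv : v ∈ K) : v 0 ≤ 1.83 := by
    have := mul_fst_le (c := 1 / 20) (by norm_num) (by norm_num) (by norm_num) hK hv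
    norm_num at this ⊢
    linarith
  have hr : -1.8 ≤ feitR 1.4 := by
    have : √(1 + 4 * 1.4) ≤ 2.6 := (Real.sqrt_le_left (by norm_num)).2 (by norm_num)
    unfold feitR
    norm_num at this ⊢
    linarith
  exact abs_le.2 ⟨neg_le_fst (by norm_num) (by norm_num) hK hM (by norm_num) (by norm_num)
    (hr.trans' (by norm_num)) hu, (hM u hu).trans (by norm_num)⟩

theorem sigmaOne_classical_le : sigmaOne 0.3 1.89 ≤ 3.921 := by
  have hadd : √(4 * 1.89 ^ 2 + (1 + |(0.3 : ℝ)|) ^ 2) ≤ 3.9974 :=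
    Real.sqrt_le_iff.2 ⟨by norm_num, by rw [abs_of_pos (by norm_num)]; norm_num⟩
  have hsub : √(4 * 1.89 ^ 2 + (1 - |(0.3 : ℝ)|) ^ 2) ≤ 3.8446 :=
    Real.sqrt_le_iff.2 ⟨by norm_num, by rw [abs_of_pos (by norm_num)]; norm_num⟩
  unfold sigmaOne
  linarith

theorem log_sigmaOne_classical_le :
    37 * Real.log (sigmaOne 0.3 1.89) ≤ 42 * -Real.log 0.3 := by
  have hσ : 0 < sigmaOne 0.3 1.89 := one_pos.trans_le (one_le_sigmaOne _ _)
  -- The exponents are chosen so that `42 / (42 + 37)` is just below `0.5319`.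
  have hpow : sigmaOne 0.3 1.89 ^ 37 ≤ (0.3⁻¹ : ℝ) ^ 42 :=
    (pow_le_pow_left₀ hσ.le sigmaOne_classical_le 37).trans (by norm_num)
  have hlog := Real.log_le_log (by positivity) hpow
  rw [Real.log_pow, Real.log_pow, Real.log_inv] at hlog
  exact_mod_cast hlog

theorem lyapunovDim_le_of_classical (hK : IsBoundedInvariant (henonMap 1.4 0.3) K) :
    lyapunovDim (henonMap 1.4 0.3) K ≤ ENNReal.ofReal 1.5319 := by
  refine (lyapunovDim_henonMap_le (by norm_num) (by norm_num [abs_of_pos]) hK.mapsTo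
    fun u hu => abs_fst_le_of_classical hK hu).trans (ENNReal.ofReal_le_ofReal ?_)
  have hσ : 0 ≤ Real.log (sigmaOne 0.3 1.89) := Real.log_nonneg (one_le_sigmaOne _ _)
  have hb : Real.log 0.3 < 0 := Real.log_neg (by norm_num) (by norm_num)
  have hquot : Real.log (sigmaOne 0.3 1.89) / (Real.log (sigmaOne 0.3 1.89) - Real.log 0.3) ≤
      0.5319 := by
    rw [div_le_iff₀ (by linarith)]
    linarith [log_sigmaOne_classical_le]
  rw [Real.log_abs]
  linarith

end ClassicalParameters

end Henon

theorem mainTheorem2_general :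
    (∀ (a b : ℝ) (u : Henon.Plane),
      Henon.sing (fderiv ℝ (Henon.henonMap a b) u) 0 = Henon.sigmaOne b (u 0) ∧
      Henon.sing (fderiv ℝ (Henon.henonMap a b) u) 1 = |b| / Henon.sigmaOne b (u 0) ∧
      1 ≤ Henon.sigmaOne b (u 0) ∧
      |b| / Henon.sigmaOne b (u 0) ≤ |b|) ∧
    (∀ a b : ℝ, 0 < a → 0 < b → b < 1 → ∀ K : Set Henon.Plane,
      Henon.IsBoundedInvariant (Henon.henonMap a b) K →
      dimH K ≤ Henon.lyapunovDim (Henon.henonMap a b) K ∧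
      Henon.lyapunovDim (Henon.henonMap a b) K ≤
        ENNReal.ofReal (1 + (1 - Real.log b /
          Real.log (Henon.sigmaOne b (Henon.feitRadius a b)))⁻¹)) ∧
    (∀ K : Set Henon.Plane, Henon.IsBoundedInvariant (Henon.henonMap 1.4 0.3) K →
      dimH K ≤ Henon.lyapunovDim (Henon.henonMap 1.4 0.3) K ∧
      Henon.lyapunovDim (Henon.henonMap 1.4 0.3) K ≤ ENNReal.ofReal 1.5319) := by
  refine ⟨fun a b u => ?_, fun a b ha hb0 hb1 K hK => ⟨?_, ?_⟩, fun K hK => ⟨?_, ?_⟩⟩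
  · have hσ := Henon.one_le_sigmaOne b (u 0)
    rw [Henon.fderiv_henonMap]
    exact ⟨Henon.sing_zero_henonDeriv b u, Henon.sing_one_henonDeriv b u, hσ,
      div_le_self (abs_nonneg b) hσ⟩
  · exact Henon.dimH_le_lyapunovDim (Henon.contDiff_henonMap a b) hK
  · have hlog := Real.log_pos (Henon.one_lt_sigmaOne b (Henon.feitRadius_pos a b).ne')
    rw [one_sub_div hlog.ne', inv_div, ← Real.log_abs b]
    exact Henon.lyapunovDim_henonMap_le hb0.ne' (abs_lt.2 ⟨by linarith, hb1⟩) hK.mapsTo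
      fun u hu => Henon.abs_fst_le_feitRadius ha.le hb0.le hb1 hK hu
  · exact Henon.dimH_le_lyapunovDim (Henon.contDiff_henonMap 1.4 0.3) hK
  · exact Henon.lyapunovDim_le_of_classical hK

theorem mainTheorem2 :
    (∀ a b : ℝ, b ≠ 0 → |b| < 1 → ∀ u : Henon.Plane,
      Henon.sing (fderiv ℝ (Henon.henonMap a b) u) 0 = Henon.sigmaOne b (u 0) ∧
      Henon.sing (fderiv ℝ (Henon.henonMap a b) u) 1 = |b| / Henon.sigmaOne b (u 0) ∧
      1 ≤ Henon.sigmaOne b (u 0) ∧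
      |b| / Henon.sigmaOne b (u 0) ≤ |b|) ∧
    (∀ a b : ℝ, 0 < a → 0 < b → b < 1 → ∀ K : Set Henon.Plane,
      Henon.IsBoundedInvariant (Henon.henonMap a b) K → K ⊆ Henon.feitRegion a b →
      dimH K ≤ Henon.lyapunovDim (Henon.henonMap a b) K ∧
      Henon.lyapunovDim (Henon.henonMap a b) K ≤
        ENNReal.ofReal (1 + (1 - Real.log b /
          Real.log (Henon.sigmaOne b (Henon.feitRadius a b)))⁻¹)) ∧
    (∀ K : Set Henon.Plane,
      Henon.IsBoundedInvariant (Henon.henonMap 1.4 0.3) K → K ⊆ Henon.feitRegion 1.4 0.3 →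
      dimH K ≤ Henon.lyapunovDim (Henon.henonMap 1.4 0.3) K ∧
      Henon.lyapunovDim (Henon.henonMap 1.4 0.3) K ≤ ENNReal.ofReal 1.5319) :=
  ⟨fun a b _ _ u => mainTheorem2_general.1 a b u,
    fun a b ha hb0 hb1 K hK _ => mainTheorem2_general.2.1 a b ha hb0 hb1 K hK,
    fun K hK _ => mainTheorem2_general.2.2 K hK⟩
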